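/- Let $n>2$, let $Cl_n$ be the real Clifford algebra generated by $e_1,\dots,e_n$ with $e_ie_j+e_je_i=-2\delta_{ij}$, with basis $e_A=e_{\alpha_1}\cdots e_{\alpha_h}$ ($A=\{\alpha_1<\dots<\alpha_h\}\subseteq\{1,\dots,n\}$) and norm $\|\sum_A a_Ae_A\|=(\sum_A a_A^2)^{1/2}$, and regard $\mathbb R^n=\operatorname{span}(e_1,\dots,e_n)$ and $\mathbb R^{n-1}=\operatorname{span}(e_1,\dots,e_{n-1})$ as subspaces of $Cl_n$. Let $A\mapsto\tilde A$ be the anti-automorphism of $Cl_n$ that fixes the vectors, and $A\mapsto A^*$ the automorphism with $x^*=-x$ for vectors $x$. Every $A\in Cl_n$ is uniquely $A=P(A)+Q(A)e_n$ with $P(A),Q(A)$ in the subalgebra $Cl_{n-1}$ generated by $\mathbb R^{n-1}$; put $Q'(A)=-e_nQ(A)e_n$. On upper half space $\mathbb R^{n,+}=\{x\in\mathbb R^n: x_n>0\}$ the Dirac-Hodge operator is $$Mf=\sum_{j=1}^n e_j\frac{\partial f}{\partial x_j}+\frac{n-2}{x_n}\,Q'(f).$$ Let $\psi(v)=(av+b)(cv+d)^{-1}$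 be a Möbius transformation mapping $\mathbb R^{n,+}$ into itself, where $(a,b,c,d)$ is a Vahlen matrix over $\mathbb R^{n-1}$: $a,b,c,d$ are finite products of vectors of $\mathbb R^{n-1}$, the elements $\tilde ac,\ \tilde cd,\ \tilde db,\ \tilde ba$ lie in $\mathbb R^{n-1}$, and $a\tilde d-b\tilde c=\pm1$. Put $$J(\psi,v)=\frac{\widetilde{cv+d}}{\|cv+d\|^2},\qquad J'(\psi,v)=\frac{\widetilde{cv+d}}{\|cv+d\|^4}.$$ Then there is a sign $\varepsilon\in\{1,-1\}$, depending only on $(a,b,c,d)$, with $(cv+d)^*=\varepsilon\,(cv+d)$ for all $v\in\mathbb R^{n,+}$ (so $\varepsilon=1$ if $cv+d$ is even and $\varepsilon=-1$ if it is odd), such that for every open set $U\subseteq\mathbb R^{n,+}$ and every $C^1$ function $\phi:U\to Cl_n$ the function $v\mapsto J(\psi,v)\phi(\psi(v))$ is $C^1$ on $\mathbb R^{n,+}\cap\psi^{-1}(U)$ and $$M\big(J(\psi,\cdot)\,\phi(\psi(\cdot))\big)(v)=\varepsilon\,J'(\psi,v)\,(M\phi)(\psi(v))\qquad\text{for all }v\in\mathbb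 R^{n,+}\text{ with }\psi(v)\in U .$$ That is, the operators $f\mapsto J(\psi,\cdot)\,f\circ\psi$ and $f\mapsto\varepsilon J'(\psi,\cdot)\,f\circ\psi$ intertwine the Dirac-Hodge operator $M$ with itself. -/

import Mathlib

noncomputable section

namespace DiracHodge

/-- Euclidean space `ℝⁿ`. -/
abbrev E (n : ℕ) : Type := EuclideanSpace ℝ (Fin n)

/-- The negative definite quadratic form `x ↦ -‖x‖²` on `ℝⁿ`. -/
def negSq (n : ℕ) : QuadraticForm ℝ (E n) :=
  -(LinearMap.BilinMap.toQuadraticMap (innerₗ (E n)))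

lemma negSq_apply {n : ℕ} (x : E n) : negSq n x = -‖x‖ ^ 2 := by
  simp [negSq]

/-- The Clifford algebra `Cl_n` of `ℝⁿ` with negative definite form, so that `x * x = -‖x‖²`. -/
abbrev Cl (n : ℕ) : Type := CliffordAlgebra (negSq n)

/-- The inclusion `ℝⁿ → Cl_n`. -/
abbrev vec {n : ℕ} (x : E n) : Cl n := CliffordAlgebra.ι (negSq n) x

/-- The standard orthonormal vector `e_j` of `ℝⁿ`. -/
abbrev e {n : ℕ} (j : Fin n) : E n := EuclideanSpace.single j 1

lemma vec_mul_self {n : ℕ} (x : E n) :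
    vec x * vec x = algebraMap ℝ (Cl n) (-‖x‖ ^ 2) := by
  rw [CliffordAlgebra.ι_sq_scalar, negSq_apply]

lemma vec_mul_vec_add {n : ℕ} (x y : E n) :
    vec x * vec y + vec y * vec x = algebraMap ℝ (Cl n) (-2 * inner ℝ x y) := by
  rw [CliffordAlgebra.ι_mul_ι_add_swap]
  congr 1
  simp only [QuadraticMap.polar, negSq_apply, norm_add_sq_real]
  ring

/-- The basis of `Cl_n` indexed by the subsets of the index set of the coordinates. Its element at
`A = {α₁ < ⋯ < α_h}` is the product `e_{α₁} ⋯ e_{α_h}`, see `clBasis_apply`. -/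
def clBasis (n : ℕ) : Module.Basis (Finset (Fin n)) ℝ (Cl n) :=
  ((EuclideanSpace.basisFun (Fin n) ℝ).toBasis.ExteriorAlgebra).map
    (CliffordAlgebra.equivExterior (negSq n)).symm

lemma contractLeft_prod {n : ℕ} (d : Module.Dual ℝ (E n)) (l : List (E n))
    (h : ∀ x ∈ l, d x = 0) :
    CliffordAlgebra.contractLeft (Q := (0 : QuadraticForm ℝ (E n))) d
      ((l.map (CliffordAlgebra.ι (0 : QuadraticForm ℝ (E n)))).prod) = 0 := by
  induction l with
  | nil => simp
  | cons x l ih =>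
    rw [List.map_cons, List.prod_cons, CliffordAlgebra.contractLeft_ι_mul,
      ih (fun y hy => h y (List.mem_cons_of_mem _ hy)), h x List.mem_cons_self]
    simp

lemma equivExterior_prod {n : ℕ} (l : List (E n))
    (h : l.Pairwise (fun x y => inner ℝ x y = 0)) :
    CliffordAlgebra.equivExterior (negSq n) ((l.map vec).prod) =
      (l.map (ExteriorAlgebra.ι ℝ)).prod := by
  induction l with
  | nil => simp [CliffordAlgebra.equivExterior]
  | cons x l ih =>
    rw [List.pairwise_cons] at h
    have ih' := ih h.2
    rw [List.map_cons, List.prod_cons, List.map_cons, List.prod_cons]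
    simp only [CliffordAlgebra.equivExterior, CliffordAlgebra.changeFormEquiv_apply] at ih' ⊢
    rw [CliffordAlgebra.changeForm_ι_mul, ih']
    have := contractLeft_prod
      (QuadraticMap.associated (R := ℝ) (-(negSq n)) x) l (fun y hy => by
        have h1 := h.1 y hy
        rw [QuadraticMap.associated_apply]
        simp [negSq_apply, norm_add_sq_real, h1])
    erw [this]
    simp

/-- The basis element at `A` is the product of the `e_j`, `j ∈ A`, in increasing order of `j`. -/
theorem clBasis_apply {n : ℕ} (A : Finset (Fin n)) :
    clBasis n A = ((A.sort (· ≤ ·)).map (fun j => vec (e j))).prod := by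
  have hs : (A.sort (· ≤ ·)).map (fun j => (vec (e j) : Cl n)) =
      ((A.sort (· ≤ ·)).map (e : Fin n → E n)).map vec := by
    rw [List.map_map]; rfl
  rw [clBasis, Module.Basis.map_apply, LinearEquiv.symm_apply_eq, hs, equivExterior_prod]
  · refine (ExteriorAlgebra.basis_apply _ A).trans ((ExteriorAlgebra.ιMulti_apply _).trans ?_)
    congr 1
    rw [List.map_map]
    apply List.ext_getElem
    · simp
    · intro i h1 h2
      simp [Set.powersetCard.ofFinEmbEquiv_symm_apply, Finset.orderEmbOfFin_apply]
  · rw [List.pairwise_map]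
    refine List.Pairwise.imp ?_ (Finset.sort_nodup A (· ≤ ·))
    intro i j hij
    simp [EuclideanSpace.inner_single_left, hij]

/-- The coordinates `(a_A)` of an element `∑ a_A e_A` of `Cl_n`. -/
def clCoord (n : ℕ) : Cl n ≃ₗ[ℝ] EuclideanSpace ℝ (Finset (Fin n)) :=
  (clBasis n).equivFun.trans (WithLp.linearEquiv 2 ℝ (Finset (Fin n) → ℝ)).symm

/-- The norm of `Cl_n` is `‖∑ a_A e_A‖ = (∑ a_A²)^{1/2}`. -/
instance (n : ℕ) : NormedAddCommGroup (Cl n) :=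
  NormedAddCommGroup.induced (Cl n) (EuclideanSpace ℝ (Finset (Fin n))) (clCoord n)
    (clCoord n).injective

instance (n : ℕ) : NormedSpace ℝ (Cl n) :=
  NormedSpace.induced ℝ (Cl n) (EuclideanSpace ℝ (Finset (Fin n))) (clCoord n)

theorem cl_norm_eq {n : ℕ} (A : Cl n) :
    ‖A‖ = Real.sqrt (∑ S : Finset (Fin n), (clBasis n).repr A S ^ 2) := by
  change ‖clCoord n A‖ = _
  rw [EuclideanSpace.norm_eq]
  simp [clCoord]

instance (n : ℕ) : FiniteDimensional ℝ (Cl n) := (clBasis n).finiteDimensional_of_finite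

/-! The ambient dimension is `m + 1`, and the last coordinate is the height in upper half space. -/

/-- The boundary hyperplane `ℝᵐ = span (e_1, …, e_m)` of upper half space in `ℝᵐ⁺¹`. -/
def boundary (m : ℕ) : Set (E (m + 1)) := {x | x (Fin.last m) = 0}

/-- Upper half space. -/
def upperHalf (m : ℕ) : Set (E (m + 1)) := {x | 0 < x (Fin.last m)}

/-- The last basis vector, as an element of the Clifford algebra. -/
abbrev eLast (m : ℕ) : Cl (m + 1) := vec (e (Fin.last m))

/-- The subalgebra `Cl_m` of `Cl_{m+1}` generated by the vectors of `ℝᵐ`. -/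
def clSub (m : ℕ) : Subalgebra ℝ (Cl (m + 1)) := Algebra.adjoin ℝ (vec '' boundary m)

/-- The projection `P` in `A = P A + (Q A) e_n` with `P A`, `Q A` in `Cl_{n-1}`; that the formula
gives this decomposition is `clP_add_clQ_mul` and `clP_clQ_unique`. -/
def clP {m : ℕ} (A : Cl (m + 1)) : Cl (m + 1) :=
  (2⁻¹ : ℝ) • (A - eLast m * CliffordAlgebra.involute A * eLast m)

/-- The projection `Q` in `A = P A + (Q A) e_n` with `P A`, `Q A` in `Cl_{n-1}`. -/
def clQ {m : ℕ} (A : Cl (m + 1)) : Cl (m + 1) :=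
  (2⁻¹ : ℝ) • (-(A * eLast m) + eLast m * CliffordAlgebra.involute A)

lemma eLast_mul_self (m : ℕ) : eLast m * eLast m = -1 := by
  rw [vec_mul_self]; simp

lemma eLast_mul_mul (m : ℕ) (A : Cl (m + 1)) : A * eLast m * eLast m = -A := by
  rw [mul_assoc, eLast_mul_self, mul_neg_one]

lemma eLast_mul_involute {m : ℕ} {B : Cl (m + 1)} (hB : B ∈ clSub m) :
    eLast m * CliffordAlgebra.involute B = B * eLast m := by
  induction hB using Algebra.adjoin_induction with
  | mem x hx =>
    obtain ⟨v, hv, rfl⟩ := hx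
    have h := vec_mul_vec_add (e (Fin.last m)) v
    have h0 : inner ℝ (e (Fin.last m)) v = 0 := by
      have hv' : v (Fin.last m) = 0 := hv
      simp [EuclideanSpace.inner_single_left, hv']
    rw [h0] at h
    simp only [mul_zero, map_zero] at h
    rw [CliffordAlgebra.involute_ι, mul_neg]
    exact neg_eq_of_add_eq_zero_right h
  | algebraMap r => simp [Algebra.commutes]
  | add x y _ _ hx hy => rw [map_add, mul_add, add_mul, hx, hy]
  | mul x y _ _ hx hy => rw [map_mul, ← mul_assoc, hx, mul_assoc, hy, mul_assoc]

theorem clP_add_clQ_mul {m : ℕ} (A : Cl (m + 1)) : clP A + clQ A * eLast m = A := by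
  simp only [clP, clQ, smul_mul_assoc, add_mul, neg_mul, eLast_mul_mul]
  rw [← smul_add]
  have : A - eLast m * CliffordAlgebra.involute A * eLast m +
      (- -A + eLast m * CliffordAlgebra.involute A * eLast m) = (2 : ℝ) • A := by
    rw [two_smul]; abel
  rw [this, smul_smul]
  norm_num

theorem clP_clQ_unique {m : ℕ} {B C : Cl (m + 1)} (hB : B ∈ clSub m) (hC : C ∈ clSub m) :
    clP (B + C * eLast m) = B ∧ clQ (B + C * eLast m) = C := by
  have hb := eLast_mul_involute hB
  have hc := eLast_mul_involute hC
  have h : eLast m * CliffordAlgebra.involute (B + C * eLast m) = B * eLast m + C := by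
    rw [map_add, map_mul, CliffordAlgebra.involute_ι, mul_add, mul_neg, mul_neg, ← mul_assoc, hb,
      hc, eLast_mul_mul, neg_neg]
  constructor
  · rw [clP, h, add_mul, eLast_mul_mul]
    have : B + C * eLast m - (-B + C * eLast m) = (2 : ℝ) • B := by rw [two_smul]; abel
    rw [this, smul_smul]
    norm_num
  · rw [clQ, h, add_mul, eLast_mul_mul]
    have : -(B * eLast m + -C) + (B * eLast m + C) = (2 : ℝ) • C := by rw [two_smul]; abel
    rw [this, smul_smul]
    norm_num

theorem exists_clSub_decomp {m : ℕ} (A : Cl (m + 1)) :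
    ∃ B ∈ clSub m, ∃ C ∈ clSub m, A = B + C * eLast m := by
  have hinv : ∀ B ∈ clSub m, CliffordAlgebra.involute B ∈ clSub m := by
    intro B hB
    induction hB using Algebra.adjoin_induction with
    | mem x hx =>
      obtain ⟨v, hv, rfl⟩ := hx
      rw [CliffordAlgebra.involute_ι]
      exact neg_mem (Algebra.subset_adjoin ⟨v, hv, rfl⟩)
    | algebraMap r => rw [AlgHom.commutes]; exact Subalgebra.algebraMap_mem _ r
    | add x y _ _ hx hy => rw [map_add]; exact add_mem hx hy
    | mul x y _ _ hx hy => rw [map_mul]; exact mul_mem hx hy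
  induction A using CliffordAlgebra.left_induction with
  | algebraMap r => exact ⟨_, Subalgebra.algebraMap_mem _ r, 0, zero_mem _, by simp⟩
  | add x y hx hy =>
    obtain ⟨B, hB, C, hC, rfl⟩ := hx
    obtain ⟨B', hB', C', hC', rfl⟩ := hy
    exact ⟨_, add_mem hB hB', _, add_mem hC hC', by rw [add_mul]; abel⟩
  | ι_mul x v hx =>
    obtain ⟨B, hB, C, hC, rfl⟩ := hx
    set t : ℝ := v (Fin.last m) with ht
    set v0 : E (m + 1) := v - t • e (Fin.last m) with hv0
    have hv : v0 ∈ boundary m := by simp [boundary, hv0, ht]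
    have hv' : vec v0 ∈ clSub m := Algebra.subset_adjoin ⟨v0, hv, rfl⟩
    have hve : CliffordAlgebra.ι (negSq (m + 1)) v = vec v0 + t • eLast m := by
      simp [hv0]
    have h1 : eLast m * B = CliffordAlgebra.involute B * eLast m := by
      rw [← eLast_mul_involute (hinv B hB), CliffordAlgebra.involute_involute]
    have h2 : eLast m * (C * eLast m) = -CliffordAlgebra.involute C := by
      rw [← mul_assoc, ← eLast_mul_mul, ← eLast_mul_involute (hinv C hC),
        CliffordAlgebra.involute_involute]
    refine ⟨vec v0 * B + t • (-CliffordAlgebra.involute C),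
      add_mem (mul_mem hv' hB) (Subalgebra.smul_mem _ (neg_mem (hinv C hC)) t),
      vec v0 * C + t • CliffordAlgebra.involute B,
      add_mem (mul_mem hv' hC) (Subalgebra.smul_mem _ (hinv B hB) t), ?_⟩
    rw [hve, add_mul, mul_add, smul_mul_assoc, mul_add, h1, h2, add_mul, smul_mul_assoc, mul_assoc,
      smul_add]
    abel

theorem clP_mem {m : ℕ} (A : Cl (m + 1)) : clP A ∈ clSub m := by
  obtain ⟨B, hB, C, hC, rfl⟩ := exists_clSub_decomp A
  rwa [(clP_clQ_unique hB hC).1]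

theorem clQ_mem {m : ℕ} (A : Cl (m + 1)) : clQ A ∈ clSub m := by
  obtain ⟨B, hB, C, hC, rfl⟩ := exists_clSub_decomp A
  rwa [(clP_clQ_unique hB hC).2]

/-- `Q' A = -e_n (Q A) e_n`. -/
def clQ' {m : ℕ} (A : Cl (m + 1)) : Cl (m + 1) := -(eLast m * clQ A * eLast m)

/-- The Euclidean Dirac operator `D f = ∑ e_j ∂f/∂x_j`. -/
def euclDirac {n : ℕ} (f : E n → Cl n) (x : E n) : Cl n :=
  ∑ j : Fin n, vec (e j) * fderiv ℝ f x (e j)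

/-- The Dirac-Hodge operator `M f = D f + ((n - 2) / x_n) Q' f`, in dimension `n = m + 1`. -/
def diracHodge {m : ℕ} (f : E (m + 1) → Cl (m + 1)) (x : E (m + 1)) : Cl (m + 1) :=
  euclDirac f x + ((((m + 1 : ℕ) : ℝ) - 2) / x (Fin.last m)) • clQ' (f x)

/-- `(a, b, c, d)` is a Vahlen matrix with entries from `ℝᵐ` (an element of `V(n - 1)`, with
`n = m + 1`): the entries are finite products of vectors from `ℝᵐ`, the products `ã c`, `c̃ d`,
`d̃ b`, `b̃ a` are vectors of `ℝᵐ`, and the pseudo-determinant `a d̃ - b c̃` is `±1`. -/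
structure IsVahlen {m : ℕ} (a b c d : Cl (m + 1)) : Prop where
  a_mem : a ∈ Submonoid.closure (vec '' boundary m)
  b_mem : b ∈ Submonoid.closure (vec '' boundary m)
  c_mem : c ∈ Submonoid.closure (vec '' boundary m)
  d_mem : d ∈ Submonoid.closure (vec '' boundary m)
  ac_vec : CliffordAlgebra.reverse a * c ∈ vec '' boundary m
  cd_vec : CliffordAlgebra.reverse c * d ∈ vec '' boundary m
  db_vec : CliffordAlgebra.reverse d * b ∈ vec '' boundary m
  ba_vec : CliffordAlgebra.reverse b * a ∈ vec '' boundary m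
  det_eq : a * CliffordAlgebra.reverse d - b * CliffordAlgebra.reverse c = 1 ∨
    a * CliffordAlgebra.reverse d - b * CliffordAlgebra.reverse c = -1

/-- `ψ` is given on upper half space by `ψ(v) = (a v + b) (c v + d)⁻¹`, and maps upper half space
to itself. (Where `c v + d` is not invertible, `Ring.inverse` is `0`; the conditions exclude this.)
-/
structure IsMoebiusOnUpperHalf {m : ℕ} (a b c d : Cl (m + 1)) (ψ : E (m + 1) → E (m + 1)) :
    Prop where
  vahlen : IsVahlen a b c d
  formula : ∀ v ∈ upperHalf m, vec (ψ v) = (a * vec v + b) * Ring.inverse (c * vec v + d)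
  mapsTo : Set.MapsTo ψ (upperHalf m) (upperHalf m)

/-- `J(ψ, v) = (c v + d)~ / ‖c v + d‖²`. -/
def J {n : ℕ} (c d : Cl n) (v : E n) : Cl n :=
  (‖c * vec v + d‖ ^ 2)⁻¹ • CliffordAlgebra.reverse (c * vec v + d)

/-- `J'(ψ, v) = (c v + d)~ / ‖c v + d‖⁴`. -/
def J' {n : ℕ} (c d : Cl n) (v : E n) : Cl n :=
  (‖c * vec v + d‖ ^ 4)⁻¹ • CliffordAlgebra.reverse (c * vec v + d)

end DiracHodge

end

open DiracHodge

namespace DiracHodge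

open CliffordAlgebra (reverse involute)

/-! Write `g = c v + d`. If `c ≠ 0`, the Vahlen conditions give `d = c w` with `w` in the boundary,
so `g = c (v + w)`. Hence `g` is always a product of vectors, has a parity `ε`, is nonzero over
upper half space and satisfies `g g~ = ε ‖g‖²`. In particular `J = ε g⁻¹`.

Differentiating `ψ g = a v + b` gives `dψ(h) = ‖g‖⁻⁴ g h g~`, a similarity of ratio `‖g‖⁻²`, and
differentiating `J g = ε` gives `dJ(h) = -ε ‖g‖⁻⁴ g~ c h g~`. Since `g~ c` is a vector `q` and `∑
e_j q e_j = (n - 2) q`, the Euclidean Dirac operator maps `J φ∘ψ` to `ε ‖g‖⁻⁴ g~ (Dφ)∘ψ` minus the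
defect `ε (n - 2) ‖g‖⁻⁴ g~ c g~ φ∘ψ` (`euclDirac_J_mul_comp`).

Moving `e_n` past `g` costs a term `2 ε v_n c`. For `Q'` this produces the extra term `ε v_n ‖g‖⁻⁴
g~ c g~ φ∘ψ` (`clQ'_J_mul`), which after multiplication by `(n - 2) / v_n` cancels the defect
exactly. The remaining `Q'` terms agree by the height formula `ψ_n = v_n / ‖g‖²` (`height_eq`). -/

/-! ### Left multiplication by vectors and the norm of `Cl_n`. -/

lemma vec_e_mul_self {n : ℕ} (j : Fin n) : vec (e j) * vec (e j) = -1 := by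
  rw [vec_mul_self]; simp

lemma vec_e_mul_vec_e {n : ℕ} {j k : Fin n} (h : j ≠ k) :
    vec (e j) * vec (e k) = -(vec (e k) * vec (e j)) := by
  have := vec_mul_vec_add (e j) (e k)
  rw [eq_neg_iff_add_eq_zero, this]
  simp [EuclideanSpace.inner_single_left, h]

/-- Insertion sort: `e_j` moves right past smaller generators, changing sign each time, until it
takes its place or cancels against another `e_j`. Thus `e_j` permutes the basis `e_A` up to signs.
-/
lemma vec_e_mul_list_prod {n : ℕ} (j : Fin n) (l : List (Fin n)) (hl : l.Pairwise (· < ·)) :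
    ∃ l' : List (Fin n), l'.Pairwise (· < ·) ∧ (∀ x, x ∈ l' ↔ Xor (x ∈ l) (x = j)) ∧
      ∃ s : ℝ, (s = 1 ∨ s = -1) ∧
        vec (e j) * (l.map (fun i => vec (e i))).prod = s • (l'.map (fun i => vec (e i))).prod := by
  induction l with
  | nil => exact ⟨[j], by simp, by simp [Xor], 1, Or.inl rfl, by simp⟩
  | cons k l ih =>
    rw [List.pairwise_cons] at hl
    rcases lt_trichotomy j k with h | h | h
    · refine ⟨j :: k :: l, ?_, ?_, 1, Or.inl rfl, by simp⟩
      · simp only [List.pairwise_cons, List.mem_cons]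
        refine ⟨?_, hl⟩
        rintro x (rfl | hx)
        exacts [h, h.trans (hl.1 x hx)]
      · intro x
        have : j ∉ k :: l := by
          simp only [List.mem_cons, not_or]
          exact ⟨h.ne, fun hj => lt_asymm h (hl.1 j hj)⟩
        simp only [List.mem_cons (a := x) (b := j), Xor]
        by_cases hx : x = j
        · subst hx; simp [this]
        · simp [hx]
    · subst h
      refine ⟨l, hl.2, ?_, -1, Or.inr rfl, ?_⟩
      · intro x
        have : j ∉ l := fun hj => lt_irrefl _ (hl.1 j hj)
        simp only [List.mem_cons, Xor]
        by_cases hx : x = j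
        · subst hx; simp [this]
        · simp [hx]
      · rw [List.map_cons, List.prod_cons, ← mul_assoc, vec_e_mul_self]; simp
    · obtain ⟨l', h1, h2, s, hs, h3⟩ := ih hl.2
      refine ⟨k :: l', ?_, ?_, -s, by rcases hs with rfl | rfl <;> simp, ?_⟩
      · rw [List.pairwise_cons]
        refine ⟨fun x hx => ?_, h1⟩
        rcases (h2 x).1 hx with ⟨hx, -⟩ | ⟨rfl, -⟩
        exacts [hl.1 x hx, h]
      · intro x
        simp only [List.mem_cons, h2, Xor]
        by_cases hx : x = k
        · subst hx; simp [h.ne]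
        · simp [hx]
      · rw [List.map_cons, List.prod_cons, ← mul_assoc, vec_e_mul_vec_e h.ne', neg_mul, mul_assoc,
          h3, List.map_cons, List.prod_cons]
        simp

lemma vec_e_mul_clBasis {n : ℕ} (j : Fin n) (A : Finset (Fin n)) :
    ∃ s : ℝ, (s = 1 ∨ s = -1) ∧
      vec (e j) * clBasis n A = s • clBasis n (symmDiff A {j}) := by
  obtain ⟨l', h1, h2, s, hs, h3⟩ := vec_e_mul_list_prod j (A.sort (· ≤ ·))
    (Finset.sortedLT_sort A).pairwise
  have : (symmDiff A {j}).sort (· ≤ ·) = l' := by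
    have h : symmDiff A {j} = l'.toFinset := by
      ext x
      simp only [List.mem_toFinset, h2, Finset.mem_sort, Finset.mem_symmDiff, Finset.mem_singleton]
      rfl
    rw [h]
    exact (List.toFinset_sort (· ≤ ·) (h1.imp ne_of_lt)).2 (h1.imp le_of_lt)
  exact ⟨s, hs, by rw [clBasis_apply, clBasis_apply, h3, this]⟩

lemma clCoord_clBasis {n : ℕ} (A : Finset (Fin n)) :
    clCoord n (clBasis n A) = EuclideanSpace.single A 1 := by
  ext B
  simp [clCoord, Finsupp.single_apply, eq_comm]

/-- The inner product of `Cl_n` for which the `e_A` are orthonormal. -/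
noncomputable def clInner (n : ℕ) : Cl n →ₗ[ℝ] Cl n →ₗ[ℝ] ℝ :=
  (innerₗ (EuclideanSpace ℝ (Finset (Fin n)))).compl₁₂ (clCoord n).toLinearMap
    (clCoord n).toLinearMap

lemma clInner_self {n : ℕ} (A : Cl n) : clInner n A A = ‖A‖ ^ 2 := by
  change inner ℝ (clCoord n A) (clCoord n A) = ‖clCoord n A‖ ^ 2
  exact real_inner_self_eq_norm_sq _

lemma clInner_clBasis {n : ℕ} (A B : Finset (Fin n)) :
    clInner n (clBasis n A) (clBasis n B) = if A = B then 1 else 0 := by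
  simp [clInner, clCoord_clBasis, EuclideanSpace.inner_single_left]

/-- `e_j` acts as a signed permutation of an orthonormal basis, hence orthogonally; with square `-1`
it is skew-adjoint. -/
lemma clInner_vec_e_mul {n : ℕ} (j : Fin n) (A B : Cl n) :
    clInner n (vec (e j) * A) B = -clInner n A (vec (e j) * B) := by
  have key : (clInner n).comp (LinearMap.mulLeft ℝ (vec (e j))) =
      -(clInner n).compl₂ (LinearMap.mulLeft ℝ (vec (e j))) := by
    refine (clBasis n).ext fun S => (clBasis n).ext fun T => ?_
    obtain ⟨s, hs, h1⟩ := vec_e_mul_clBasis j S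
    obtain ⟨t, ht, h2⟩ := vec_e_mul_clBasis j T
    simp only [LinearMap.comp_apply, LinearMap.neg_apply, LinearMap.compl₂_apply,
      LinearMap.mulLeft_apply, h1, h2, map_smul, LinearMap.smul_apply, clInner_clBasis,
      smul_eq_mul]
    by_cases h : symmDiff S {j} = T
    · have h' : S = symmDiff T {j} := by rw [← h, symmDiff_symmDiff_cancel_right]
      rw [if_pos h, if_pos h']
      -- Applying `e_j` twice gives `-1`, so the two signs satisfy `s t = -1`, that is, `s = -t`.
      have h3 : vec (e j) * (vec (e j) * clBasis n S) = (s * t) • clBasis n S := by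
        rw [h1, h, mul_smul_comm, h2, ← h', smul_smul]
      rw [← mul_assoc, vec_e_mul_self, neg_one_mul] at h3
      have h4 : (s * t + 1) • clBasis n S = 0 := by rw [add_smul, ← h3]; simp
      have h5 := (smul_eq_zero.1 h4).resolve_right ((clBasis n).ne_zero S)
      rcases hs with rfl | rfl <;> rcases ht with rfl | rfl <;>
        norm_num at h5 <;> norm_num
    · have h' : S ≠ symmDiff T {j} := by
        rintro rfl; exact h (symmDiff_symmDiff_cancel_right _ _)
      rw [if_neg h, if_neg h']; simp
  exact LinearMap.congr_fun₂ key A B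

lemma sum_smul_e {n : ℕ} (x : E n) : ∑ j, x j • e j = x := by
  simpa using (EuclideanSpace.basisFun (Fin n) ℝ).sum_repr x

lemma clInner_vec_mul {n : ℕ} (x : E n) (A B : Cl n) :
    clInner n (vec x * A) B = -clInner n A (vec x * B) := by
  have h : vec x = ∑ j, x j • vec (e j) := by
    conv_lhs => rw [← sum_smul_e x]
    simp only [map_sum, map_smul]
  simp only [h, Finset.sum_mul, smul_mul_assoc, map_sum, map_smul, LinearMap.sum_apply,
    LinearMap.smul_apply, clInner_vec_e_mul, smul_neg, Finset.sum_neg_distrib]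

/-- Multiplication by a vector scales the norm of `Cl_n`. -/
lemma norm_sq_vec_mul {n : ℕ} (x : E n) (A : Cl n) : ‖vec x * A‖ ^ 2 = ‖x‖ ^ 2 * ‖A‖ ^ 2 := by
  rw [← clInner_self, clInner_vec_mul, ← mul_assoc, vec_mul_self, ← Algebra.smul_def, map_smul,
    clInner_self, smul_eq_mul]
  ring

lemma norm_one_sq (n : ℕ) : ‖(1 : Cl n)‖ ^ 2 = 1 := by
  have : clBasis n ∅ = 1 := by rw [clBasis_apply]; simp
  rw [← clInner_self, ← this, clInner_clBasis, if_pos rfl]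

/-! ### Conjugation and parity of products of vectors. -/

/-- The Clifford conjugate `x ↦ (x*)~`. -/
noncomputable abbrev conj {n : ℕ} (A : Cl n) : Cl n :=
  CliffordAlgebra.reverse (CliffordAlgebra.involute A)

lemma conj_vec {n : ℕ} (x : E n) : conj (vec x) = -vec x := by
  simp [conj, CliffordAlgebra.involute_ι, CliffordAlgebra.reverse_ι]

lemma conj_mul {n : ℕ} (A B : Cl n) : conj (A * B) = conj B * conj A := by
  simp [conj, CliffordAlgebra.reverse.map_mul]

/-- The products of vectors in `Cl_n`. -/
noncomputable abbrev vecProd (n : ℕ) : Submonoid (Cl n) := Submonoid.closure (Set.range vec)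

/-- By induction on the factors: peeling off `x` on the left contributes `-x² = ‖x‖²` on both sides.
This makes nonzero products of vectors invertible. -/
lemma mul_conj_of_mem {n : ℕ} {A : Cl n} (hA : A ∈ vecProd n) :
    A * conj A = algebraMap ℝ (Cl n) (‖A‖ ^ 2) := by
  induction hA using Submonoid.closure_induction_left with
  | one => simp [conj, norm_one_sq]
  | mul_left x hx y hy ih =>
    obtain ⟨x, rfl⟩ := hx
    rw [conj_mul, conj_vec, norm_sq_vec_mul, mul_assoc, ← mul_assoc y, ih, Algebra.left_comm,
      mul_neg, vec_mul_self, ← map_neg, ← map_mul]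
    congr 1; ring

lemma norm_sq_pos {n : ℕ} {A : Cl n} (h : A ≠ 0) : 0 < ‖A‖ ^ 2 := by positivity

lemma conj_mul_of_mem {n : ℕ} {A : Cl n} (hA : A ∈ vecProd n) :
    conj A * A = algebraMap ℝ (Cl n) (‖A‖ ^ 2) := by
  induction hA using Submonoid.closure_induction_left with
  | one => simp [conj, norm_one_sq]
  | mul_left x hx y hy ih =>
    obtain ⟨x, rfl⟩ := hx
    rw [conj_mul, conj_vec, norm_sq_vec_mul, mul_assoc, ← mul_assoc (-vec x), neg_mul,
      vec_mul_self, ← map_neg, Algebra.left_comm, ih, ← map_mul]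
    congr 1; ring

lemma involute_of_mem {n : ℕ} {A : Cl n} (hA : A ∈ vecProd n) :
    ∃ s : ℝ, (s = 1 ∨ s = -1) ∧ CliffordAlgebra.involute A = s • A := by
  induction hA using Submonoid.closure_induction_left with
  | one => exact ⟨1, Or.inl rfl, by simp⟩
  | mul_left x hx y hy ih =>
    obtain ⟨x, rfl⟩ := hx
    obtain ⟨s, hs, h⟩ := ih
    refine ⟨-s, by rcases hs with rfl | rfl <;> simp, ?_⟩
    rw [map_mul, CliffordAlgebra.involute_ι, h]; simp

/-! ### The denominator `g = c v + d` of a Vahlen matrix. -/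

variable {m : ℕ} {a b c d : Cl (m + 1)} {ε : ℝ}

lemma closure_boundary_le : Submonoid.closure (vec '' boundary m) ≤ vecProd (m + 1) :=
  Submonoid.closure_mono (Set.image_subset_range _ _)

lemma vec_mem_vecProd {n : ℕ} (x : E n) : vec x ∈ vecProd n :=
  Submonoid.subset_closure ⟨x, rfl⟩

lemma closure_boundary_subset {x : Cl (m + 1)}
    (hx : x ∈ Submonoid.closure (vec '' boundary m)) : x ∈ clSub m :=
  (Submonoid.closure_le (S := (clSub m).toSubmonoid)).2 Algebra.subset_adjoin hx

/-- The last basis vector commutes with `x ∈ Cl_{n-1}` up to the parity of `x`. -/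
lemma eLast_mul_of_involute {x : Cl (m + 1)} (hx : x ∈ Submonoid.closure (vec '' boundary m))
    {s : ℝ} (hs : s = 1 ∨ s = -1) (h : involute x = s • x) :
    eLast m * x = s • (x * eLast m) := by
  have h1 := eLast_mul_involute (closure_boundary_subset hx)
  rw [h] at h1
  rw [← h1, mul_smul_comm, smul_smul]
  rcases hs with rfl | rfl <;> simp

lemma eLast_mul_vec (v : E (m + 1)) :
    eLast m * vec v = -(vec v * eLast m) - (2 * v (Fin.last m)) • (1 : Cl (m + 1)) := by
  have h := vec_mul_vec_add (e (Fin.last m)) v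
  rw [eq_sub_of_add_eq h, Algebra.algebraMap_eq_smul_one]
  simp [EuclideanSpace.inner_single_left, sub_eq_add_neg, add_comm]

lemma vec_injective {n : ℕ} : Function.Injective (vec : E n → Cl n) := by
  rw [injective_iff_map_eq_zero' (CliffordAlgebra.ι (negSq n))]
  intro x
  refine ⟨fun h => ?_, fun h => by rw [h, map_zero]⟩
  have h1 := norm_sq_vec_mul x 1
  rw [norm_one_sq, show vec x = 0 from h] at h1
  simpa using h1.symm

lemma mul_ne_zero_of_mem {n : ℕ} {A B : Cl n} (hA : A ∈ vecProd n) (hA0 : A ≠ 0) (hB : B ≠ 0) :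
    A * B ≠ 0 := by
  intro h
  have h1 : conj A * (A * B) = 0 := by rw [h, mul_zero]
  rw [← mul_assoc, conj_mul_of_mem hA, ← Algebra.smul_def] at h1
  exact (smul_eq_zero.1 h1).elim (norm_sq_pos hA0).ne' hB

lemma conj_eq_smul_reverse {n : ℕ} {A : Cl n} {s : ℝ} (h : involute A = s • A) :
    conj A = s • reverse A := by
  rw [conj, h, map_smul]

/-- Multiply the vector `c~ d` by `c` on the left: `c c~` is a nonzero scalar. -/
lemma IsVahlen.eq_mul_vec (hV : IsVahlen a b c d) (hc : c ≠ 0) :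
    ∃ w ∈ boundary m, d = c * vec w := by
  have hcm := closure_boundary_le hV.c_mem
  obtain ⟨s, hs, h⟩ := involute_of_mem hcm
  obtain ⟨w, hw, hw'⟩ := hV.cd_vec
  have h1 := mul_conj_of_mem hcm
  rw [conj_eq_smul_reverse h, mul_smul_comm] at h1
  have h2 : c * vec w = (s * ‖c‖ ^ 2) • d := by
    have hss : s * s = 1 := by rcases hs with rfl | rfl <;> norm_num
    have : c * reverse c = s • algebraMap ℝ (Cl (m + 1)) (‖c‖ ^ 2) := by
      rw [← h1, smul_smul, hss, one_smul]
    rw [hw', ← mul_assoc, this, smul_mul_assoc, ← Algebra.smul_def, smul_smul]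
  have h0 : s * ‖c‖ ^ 2 ≠ 0 :=
    mul_ne_zero (by rcases hs with rfl | rfl <;> norm_num) (norm_sq_pos hc).ne'
  refine ⟨(s * ‖c‖ ^ 2)⁻¹ • w, ?_, ?_⟩
  · have : w (Fin.last m) = 0 := hw
    simp [boundary, this]
  · rw [vec, map_smul, mul_smul_comm]
    rw [show c * (CliffordAlgebra.ι (negSq (m + 1))) w = _ from h2, smul_smul,
      inv_mul_cancel₀ h0, one_smul]

lemma IsVahlen.ne_zero (hV : IsVahlen a b c d) (hc : c = 0) : d ≠ 0 := by
  rintro rfl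
  subst hc
  rcases hV.det_eq with h | h <;> simp at h

/-- `ε` is the parity of `d` if `c = 0`; otherwise it is opposite to that of `c`, because `d = c w`
has one more vector factor. -/
lemma IsVahlen.exists_parity (hV : IsVahlen a b c d) :
    ∃ ε : ℝ, (ε = 1 ∨ ε = -1) ∧ involute c = (-ε) • c ∧ involute d = ε • d := by
  rcases eq_or_ne c 0 with hc | hc
  · obtain ⟨s, hs, h⟩ := involute_of_mem (closure_boundary_le hV.d_mem)
    exact ⟨s, hs, by simp [hc], h⟩
  · obtain ⟨s, hs, h⟩ := involute_of_mem (closure_boundary_le hV.c_mem)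
    obtain ⟨w, -, hw⟩ := hV.eq_mul_vec hc
    refine ⟨-s, by rcases hs with rfl | rfl <;> simp, by simpa using h, ?_⟩
    rw [hw, map_mul, CliffordAlgebra.involute_ι, h]; simp

lemma IsVahlen.mul_reverse_comm (hV : IsVahlen a b c d) : c * reverse d = d * reverse c := by
  rcases eq_or_ne c 0 with hc | hc
  · simp [hc]
  · obtain ⟨w, -, hw⟩ := hV.eq_mul_vec hc
    rw [hw, CliffordAlgebra.reverse.map_mul, CliffordAlgebra.reverse_ι, mul_assoc]

lemma IsVahlen.denom_mem (hV : IsVahlen a b c d) (v : E (m + 1)) :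
    c * vec v + d ∈ vecProd (m + 1) := by
  rcases eq_or_ne c 0 with hc | hc
  · simpa [hc] using closure_boundary_le hV.d_mem
  · obtain ⟨w, -, hw⟩ := hV.eq_mul_vec hc
    rw [hw, ← mul_add, ← map_add]
    exact mul_mem (closure_boundary_le hV.c_mem) (vec_mem_vecProd _)

/-- In `c (v + w)` the vector `v + w` has the positive height of `v`, as `w` lies in the boundary.
-/
lemma IsVahlen.denom_ne_zero (hV : IsVahlen a b c d) {v : E (m + 1)} (hv : v ∈ upperHalf m) :
    c * vec v + d ≠ 0 := by
  rcases eq_or_ne c 0 with hc | hc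
  · simpa [hc] using hV.ne_zero hc
  · obtain ⟨w, hw0, hw⟩ := hV.eq_mul_vec hc
    rw [hw, ← mul_add, ← map_add]
    refine mul_ne_zero_of_mem (closure_boundary_le hV.c_mem) hc fun h => ?_
    have h1 : v + w = 0 := vec_injective (h.trans (map_zero _).symm)
    have h2 := congrArg (fun x : E (m + 1) => x (Fin.last m)) h1
    have h3 : w (Fin.last m) = 0 := hw0
    have h4 : 0 < v (Fin.last m) := hv
    simp [h3] at h2
    exact h4.ne' h2

lemma involute_denom (hc : involute c = (-ε) • c) (hd : involute d = ε • d) (v : E (m + 1)) :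
    involute (c * vec v + d) = ε • (c * vec v + d) := by
  rw [map_add, map_mul, CliffordAlgebra.involute_ι, hc, hd]; simp

lemma sq_sign (hε : ε = 1 ∨ ε = -1) : ε * ε = 1 := by
  rcases hε with rfl | rfl <;> norm_num

lemma reverse_eq_smul_conj {n : ℕ} {A : Cl n} (hε : ε = 1 ∨ ε = -1) (h : involute A = ε • A) :
    reverse A = ε • conj A := by
  rw [conj_eq_smul_reverse h, smul_smul, sq_sign hε, one_smul]

lemma mul_reverse_of_mem {n : ℕ} {A : Cl n} (hA : A ∈ vecProd n) (hε : ε = 1 ∨ ε = -1)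
    (h : involute A = ε • A) : A * reverse A = (ε * ‖A‖ ^ 2) • (1 : Cl n) := by
  rw [reverse_eq_smul_conj hε h, mul_smul_comm, mul_conj_of_mem hA,
    Algebra.algebraMap_eq_smul_one, smul_smul]

lemma reverse_mul_of_mem {n : ℕ} {A : Cl n} (hA : A ∈ vecProd n) (hε : ε = 1 ∨ ε = -1)
    (h : involute A = ε • A) : reverse A * A = (ε * ‖A‖ ^ 2) • (1 : Cl n) := by
  rw [reverse_eq_smul_conj hε h, smul_mul_assoc, conj_mul_of_mem hA,
    Algebra.algebraMap_eq_smul_one, smul_smul]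

/-- `g~ c = (v + w) c~ c` and `c~ c` is a scalar. This vector is what the sandwich sum `∑ e_j q e_j`
is applied to. -/
lemma IsVahlen.exists_vec_eq (hV : IsVahlen a b c d) (hε : ε = 1 ∨ ε = -1)
    (hc : involute c = (-ε) • c) (v : E (m + 1)) :
    ∃ q : E (m + 1), reverse (c * vec v + d) * c = vec q := by
  rcases eq_or_ne c 0 with h | h
  · exact ⟨0, by simp [h]⟩
  · obtain ⟨w, hw0, hw⟩ := hV.eq_mul_vec h
    have hε' : -ε = 1 ∨ -ε = -1 := by rcases hε with rfl | rfl <;> simp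
    refine ⟨(-ε * ‖c‖ ^ 2) • (v + w), ?_⟩
    rw [hw, ← mul_add, ← map_add, CliffordAlgebra.reverse.map_mul, CliffordAlgebra.reverse_ι,
      mul_assoc, reverse_mul_of_mem (closure_boundary_le hV.c_mem) hε' hc]
    simp [add_comm]

/-- `e_n` commutes with `c v` and `d` up to the same sign `ε`, except for the scalar `-2 v_n` from
swapping `e_n` and `v`. -/
lemma IsVahlen.eLast_mul_denom (hV : IsVahlen a b c d) (hε : ε = 1 ∨ ε = -1)
    (hc : involute c = (-ε) • c) (hd : involute d = ε • d) (v : E (m + 1)) :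
    eLast m * (c * vec v + d) =
      (2 * ε * v (Fin.last m)) • c + ε • ((c * vec v + d) * eLast m) := by
  have hε' : -ε = 1 ∨ -ε = -1 := by rcases hε with rfl | rfl <;> simp
  rw [mul_add, ← mul_assoc, eLast_mul_of_involute hV.c_mem hε' hc,
    eLast_mul_of_involute hV.d_mem hε hd, smul_mul_assoc, mul_assoc c, eLast_mul_vec, mul_sub,
    mul_smul_comm, mul_one, add_mul, mul_assoc c, mul_neg]
  module

/-! ### Parity, pseudo-determinant and height for `ψ`. -/

variable {ψ : E (m + 1) → E (m + 1)}

lemma IsMoebiusOnUpperHalf.mul_denom (h : IsMoebiusOnUpperHalf a b c d ψ) {v : E (m + 1)}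
    (hv : v ∈ upperHalf m) : vec (ψ v) * (c * vec v + d) = a * vec v + b := by
  have hmem := h.vahlen.denom_mem v
  have hr := (norm_sq_pos (h.vahlen.denom_ne_zero hv)).ne'
  have hu : IsUnit (c * vec v + d) := by
    refine ⟨⟨c * vec v + d, (‖c * vec v + d‖ ^ 2)⁻¹ • conj (c * vec v + d), ?_, ?_⟩, rfl⟩
    · rw [mul_smul_comm, mul_conj_of_mem hmem, Algebra.algebraMap_eq_smul_one, smul_smul,
        inv_mul_cancel₀ hr, one_smul]
    · rw [smul_mul_assoc, conj_mul_of_mem hmem, Algebra.algebraMap_eq_smul_one, smul_smul,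
        inv_mul_cancel₀ hr, one_smul]
  rw [h.formula v hv, mul_assoc, Ring.inverse_mul_cancel _ hu, mul_one]

lemma IsMoebiusOnUpperHalf.involute_num (h : IsMoebiusOnUpperHalf a b c d ψ)
    (hc : involute c = (-ε) • c) (hd : involute d = ε • d) :
    involute a = ε • a ∧ involute b = (-ε) • b := by
  have key : ∀ v ∈ upperHalf m, -(involute a * vec v) + involute b = (-ε) • (a * vec v + b) := by
    intro v hv
    have h1 := congrArg involute (h.mul_denom hv)
    rw [map_mul, CliffordAlgebra.involute_ι, involute_denom hc hd, neg_mul, mul_smul_comm,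
      h.mul_denom hv, map_add, map_mul, CliffordAlgebra.involute_ι, mul_neg] at h1
    rw [← h1, neg_smul]
  -- The relation is affine in `v`; its values at `e_n` and `2 e_n` separate `a` from `b`.
  have h1 := key (e (Fin.last m)) (by simp [upperHalf])
  have h2 := key ((2 : ℝ) • e (Fin.last m)) (by simp [upperHalf])
  simp only [map_smul, mul_smul_comm] at h2
  have h3 : involute a * eLast m = ε • (a * eLast m) := by
    have h5 := congrArg₂ (· - ·) h1 h2
    calc involute a * eLast m = (-(involute a * eLast m) + involute b) -
          (-((2 : ℝ) • (involute a * eLast m)) + involute b) := by module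
      _ = _ := h5
      _ = _ := by module
  have h4 : involute a = ε • a := by
    have := congrArg (· * eLast m) h3
    simpa [eLast_mul_mul, smul_mul_assoc] using this
  refine ⟨h4, ?_⟩
  rw [h3] at h1
  rw [eq_comm] at h1
  have : involute b = (-ε) • (a * eLast m + b) + ε • (a * eLast m) := by rw [h1]; abel
  rw [this]; module

/-- With `D = a d~ - b c~`, the pseudo-determinant, one has `(a - ψ c) (c v + d)~ = D`. -/
lemma IsMoebiusOnUpperHalf.sub_mul_reverse (h : IsMoebiusOnUpperHalf a b c d ψ) {v : E (m + 1)}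
    (hv : v ∈ upperHalf m) :
    (a - vec (ψ v) * c) * reverse (c * vec v + d) = a * reverse d - b * reverse c := by
  have h1 : c * reverse (c * vec v + d) = (c * vec v + d) * reverse c := by
    rw [map_add, CliffordAlgebra.reverse.map_mul, CliffordAlgebra.reverse_ι, mul_add,
      h.vahlen.mul_reverse_comm, add_mul, mul_assoc]
  rw [sub_mul, mul_assoc, h1, ← mul_assoc, h.mul_denom hv, map_add,
    CliffordAlgebra.reverse.map_mul, CliffordAlgebra.reverse_ι]
  noncomm_ring

/-- The height is read off from `e_n ψ + ψ e_n = -2 ψ_n`. Multiplied by `g` on the right, the left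
side becomes `-2 ε v_n (a - ψ c)`; multiplying by `g~` turns `a - ψ c` into the pseudo-determinant.
-/
lemma IsMoebiusOnUpperHalf.norm_sq_mul_height (h : IsMoebiusOnUpperHalf a b c d ψ)
    (hε : ε = 1 ∨ ε = -1) (hc : involute c = (-ε) • c) (hd : involute d = ε • d) {v : E (m + 1)}
    (hv : v ∈ upperHalf m) :
    (‖c * vec v + d‖ ^ 2 * ψ v (Fin.last m)) • (1 : Cl (m + 1)) =
      v (Fin.last m) • (a * reverse d - b * reverse c) := by
  obtain ⟨ha, hb⟩ := h.involute_num hc hd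
  have hε' : -ε = 1 ∨ -ε = -1 := by rcases hε with rfl | rfl <;> simp
  have hk : eLast m * (a * vec v + b) =
      -((2 * ε * v (Fin.last m)) • a + ε • ((a * vec v + b) * eLast m)) := by
    rw [mul_add, ← mul_assoc, eLast_mul_of_involute h.vahlen.a_mem hε ha,
      eLast_mul_of_involute h.vahlen.b_mem hε' hb, smul_mul_assoc, mul_assoc a, eLast_mul_vec,
      mul_sub, mul_smul_comm, mul_one, add_mul, mul_assoc a, mul_neg]
    module
  have hg := h.vahlen.eLast_mul_denom hε hc hd v
  set g := c * vec v + d with hgdef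
  have hgr : g * reverse g = _ :=
    mul_reverse_of_mem (h.vahlen.denom_mem v) hε (involute_denom hc hd v)
  have h1 : (eLast m * vec (ψ v) + vec (ψ v) * eLast m) * g =
      -((2 * ε * v (Fin.last m)) • (a - vec (ψ v) * c)) := by
    rw [add_mul, mul_assoc, mul_assoc, h.mul_denom hv, hk, hg, mul_add, mul_smul_comm,
      mul_smul_comm, ← mul_assoc (vec (ψ v)) g, h.mul_denom hv]
    module
  have h2 := congrArg (· * reverse g) h1
  simp only [neg_mul, smul_mul_assoc] at h2
  rw [h.sub_mul_reverse hv, mul_assoc, hgr, eLast_mul_vec] at h2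
  have h3 := congrArg ((-(ε / 2)) • ·) h2
  have hεε := sq_sign hε
  rw [mul_smul_comm, mul_one, smul_neg, smul_smul, smul_smul, ← neg_smul] at h3
  have h4 : -(-(ε / 2) * (2 * ε * v (Fin.last m))) = v (Fin.last m) := by
    linear_combination v (Fin.last m) * hεε
  rw [h4] at h3
  rw [← h3]
  have h5 : ‖g‖ ^ 2 * ψ v (Fin.last m) = (ε * ε) * (‖g‖ ^ 2 * ψ v (Fin.last m)) := by
    rw [hεε, one_mul]
  rw [h5]
  module

/-- The value `-1` would give `e_n` an image of negative height. -/
lemma IsMoebiusOnUpperHalf.det_eq_one (h : IsMoebiusOnUpperHalf a b c d ψ) :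
    a * reverse d - b * reverse c = 1 := by
  obtain ⟨ε, hε, hc, hd⟩ := h.vahlen.exists_parity
  refine h.vahlen.det_eq.resolve_right fun hdet => ?_
  have hv : e (Fin.last m) ∈ upperHalf m := by simp [upperHalf]
  have h1 := h.norm_sq_mul_height hε hc hd hv
  rw [hdet, smul_neg, ← neg_smul, ← sub_eq_zero, ← sub_smul] at h1
  have h2 : 0 < ψ (e (Fin.last m)) (Fin.last m) := h.mapsTo hv
  have h3 := norm_sq_pos (h.vahlen.denom_ne_zero hv)
  have h5 := (smul_eq_zero.1 h1).resolve_right one_ne_zero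
  have : 0 < ‖c * vec (e (Fin.last m)) + d‖ ^ 2 * ψ (e (Fin.last m)) (Fin.last m) := by positivity
  simp at h5
  linarith

/-- The height formula `(ψ v)_n = v_n / ‖c v + d‖²`. -/
lemma IsMoebiusOnUpperHalf.height_eq (h : IsMoebiusOnUpperHalf a b c d ψ) {v : E (m + 1)}
    (hv : v ∈ upperHalf m) : ψ v (Fin.last m) = v (Fin.last m) / ‖c * vec v + d‖ ^ 2 := by
  obtain ⟨ε, hε, hc, hd⟩ := h.vahlen.exists_parity
  have h1 := h.norm_sq_mul_height hε hc hd hv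
  rw [h.det_eq_one] at h1
  have h3 := norm_sq_pos (h.vahlen.denom_ne_zero hv)
  rw [eq_div_iff h3.ne', mul_comm]
  exact smul_left_injective ℝ (one_ne_zero (α := Cl (m + 1))) h1

/-- This is `a - ψ c = g~⁻¹`, the coefficient that appears when `ψ g = a v + b` is differentiated.
-/
lemma IsMoebiusOnUpperHalf.norm_sq_smul_sub (h : IsMoebiusOnUpperHalf a b c d ψ)
    (hε : ε = 1 ∨ ε = -1) (hc : involute c = (-ε) • c) (hd : involute d = ε • d) {v : E (m + 1)}
    (hv : v ∈ upperHalf m) :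
    ‖c * vec v + d‖ ^ 2 • (a - vec (ψ v) * c) = ε • (c * vec v + d) := by
  have h1 := congrArg (ε • · * (c * vec v + d)) (h.sub_mul_reverse hv)
  simp only [smul_mul_assoc, mul_assoc] at h1
  rw [reverse_mul_of_mem (h.vahlen.denom_mem v) hε (involute_denom hc hd v), h.det_eq_one, one_mul,
    mul_smul_comm, mul_one, smul_smul, ← mul_assoc, sq_sign hε, one_mul] at h1
  exact h1

/-! ### Calculus in `Cl_n` and sums over orthonormal bases. -/

/-- The multiplication of `Cl_n` as a continuous bilinear map. -/
noncomputable def clMul (n : ℕ) : Cl n →L[ℝ] Cl n →L[ℝ] Cl n :=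
  (LinearMap.mul ℝ (Cl n)).toContinuousBilinearMap

@[simp] lemma clMul_apply {n : ℕ} (A B : Cl n) : clMul n A B = A * B := rfl

/-- The inclusion of the vectors as a continuous linear map. -/
noncomputable def vecL (n : ℕ) : E n →L[ℝ] Cl n :=
  LinearMap.toContinuousLinearMap (CliffordAlgebra.ι (negSq n))

@[simp] lemma vecL_apply {n : ℕ} (x : E n) : vecL n x = vec x := rfl

section Calculus

variable {n : ℕ} {F : Type*} [NormedAddCommGroup F] [NormedSpace ℝ F]

lemma fderiv_cl_mul {f g : F → Cl n} {x : F} (hf : DifferentiableAt ℝ f x)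
    (hg : DifferentiableAt ℝ g x) (h : F) :
    fderiv ℝ (fun y => f y * g y) x h = f x * fderiv ℝ g x h + fderiv ℝ f x h * g x := by
  have := ((clMul n).hasFDerivAt_of_bilinear hf.hasFDerivAt hg.hasFDerivAt).fderiv
  simp only [clMul_apply] at this
  rw [this]
  simp

lemma contDiffOn_cl_mul {f g : F → Cl n} {s : Set F} {k : WithTop ℕ∞} (hf : ContDiffOn ℝ k f s)
    (hg : ContDiffOn ℝ k g s) : ContDiffOn ℝ k (fun y => f y * g y) s :=
  ((clMul n).contDiff.comp_contDiffOn hf).clm_apply hg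

lemma contDiff_cl_norm_sq {k : WithTop ℕ∞} : ContDiff ℝ k (fun A : Cl n => ‖A‖ ^ 2) :=
  (contDiff_norm_sq ℝ (E := EuclideanSpace ℝ (Finset (Fin n)))).comp
    (LinearMap.toContinuousLinearMap (clCoord n).toLinearMap).contDiff

lemma contDiff_denom (c d : Cl n) {k : WithTop ℕ∞} :
    ContDiff ℝ k (fun v : E n => c * vec v + d) :=
  ((clMul n c).comp (vecL n)).contDiff.add contDiff_const

lemma fderiv_denom (c d : Cl n) (v h : E n) :
    fderiv ℝ (fun v : E n => c * vec v + d) v h = c * vec h := by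
  have : HasFDerivAt (fun v : E n => c * vec v + d) ((clMul n c).comp (vecL n)) v :=
    ((clMul n c).comp (vecL n)).hasFDerivAt.add_const d
  rw [this.fderiv]; rfl

/-- Transfers smoothness from the `Cl_n`-valued map `vec ∘ ψ` to `ψ`. -/
lemma exists_vec_leftInverse (n : ℕ) : ∃ p : Cl n →L[ℝ] E n, ∀ x : E n, p (vec x) = x := by
  obtain ⟨p, hp⟩ := LinearMap.exists_leftInverse_of_injective (CliffordAlgebra.ι (negSq n))
    (LinearMap.ker_eq_bot.2 vec_injective)
  exact ⟨LinearMap.toContinuousLinearMap p, fun x => LinearMap.congr_fun hp x⟩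

lemma sum_vec_e_mul_vec_mul (q : E n) :
    ∑ j, vec (e j) * vec q * vec (e j) = ((n : ℝ) - 2) • vec q := by
  have h : ∀ j : Fin n, vec (e j) * vec q * vec (e j) = vec q - (2 : ℝ) • (q j • vec (e j)) := by
    intro j
    have h1 := vec_mul_vec_add (e j) q
    rw [eq_sub_of_add_eq h1, Algebra.algebraMap_eq_smul_one, sub_mul, mul_assoc (vec q), vec_e_mul_self,
      mul_neg_one]
    simp only [EuclideanSpace.inner_single_left, smul_mul_assoc, one_mul, map_one]
    module
  have h2 : ∑ j, q j • vec (e j) = vec q := by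
    conv_rhs => rw [← sum_smul_e q]
    simp only [map_sum, map_smul]
  rw [Finset.sum_congr rfl (fun j _ => h j), Finset.sum_sub_distrib, ← Finset.smul_sum, h2]
  simp only [Finset.sum_const, Finset.card_univ, Fintype.card_fin]
  module

/-- The Dirac sum `∑ e_j L(e_j)` scales by `μ²` under a linear similarity of ratio `μ`. -/
lemma sum_vec_mul_of_similarity (T : E n →ₗ[ℝ] E n) {μ : ℝ} (hμ : 0 < μ)
    (hT : ∀ h, ‖T h‖ = μ * ‖h‖) (L : E n →ₗ[ℝ] Cl n) :
    ∑ j, vec (T (e j)) * L (T (e j)) = μ ^ 2 • ∑ j, vec (e j) * L (e j) := by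
  let S : E n →ₗᵢ[ℝ] E n :=
    { toLinearMap := μ⁻¹ • T
      norm_map' := fun x => by
        simp only [LinearMap.smul_apply, norm_smul, hT, norm_inv, Real.norm_eq_abs, abs_of_pos hμ]
        field_simp }
  have hS : ∀ x, T x = μ • S x := fun x => by
    change _ = μ • (μ⁻¹ • T x)
    rw [smul_smul, mul_inv_cancel₀ hμ.ne', one_smul]
  let B := (EuclideanSpace.basisFun (Fin n) ℝ).map (S.toLinearIsometryEquiv rfl)
  have hB : ∀ j, B j = S (e j) := fun j => by simp [B]
  -- The Dirac sum does not depend on the orthonormal basis.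
  have key : ∑ j, vec (B j) * L (B j) = ∑ j, vec (e j) * L (e j) := by
    have h1 : ∀ i, L (e i) = ∑ j, inner ℝ (B j) (e i) • L (B j) := fun i => by
      conv_lhs => rw [← B.sum_repr' (e i)]
      simp only [map_sum, map_smul]
    have h2 : ∀ j, vec (B j) = ∑ i, inner ℝ (B j) (e i) • vec (e i) := fun j => by
      conv_lhs => rw [← sum_smul_e (B j)]
      simp [map_sum, map_smul, EuclideanSpace.inner_single_right]
    calc ∑ j, vec (B j) * L (B j)
        = ∑ j, ∑ i, inner ℝ (B j) (e i) • (vec (e i) * L (B j)) := by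
          refine Finset.sum_congr rfl fun j _ => ?_
          conv_lhs => rw [h2 j]
          simp only [Finset.sum_mul, smul_mul_assoc]
      _ = ∑ i, vec (e i) * L (e i) := by
          rw [Finset.sum_comm]
          refine Finset.sum_congr rfl fun i _ => ?_
          rw [h1 i]
          simp only [Finset.mul_sum, mul_smul_comm]
  rw [← key, Finset.smul_sum]
  refine Finset.sum_congr rfl fun j _ => ?_
  rw [hB, hS]
  simp only [map_smul, smul_mul_assoc, mul_smul_comm, smul_smul, sq]

end Calculus

/-! ### Smoothness and derivatives of `J` and `ψ`. -/

lemma isOpen_upperHalf : IsOpen (upperHalf m) :=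
  isOpen_lt continuous_const (by fun_prop)

lemma IsVahlen.contDiffOn_J (hV : IsVahlen a b c d) {k : WithTop ℕ∞} :
    ContDiffOn ℝ k (J c d) (upperHalf m) := by
  have h1 : ContDiffOn ℝ k (fun v : E (m + 1) => (‖c * vec v + d‖ ^ 2)⁻¹) (upperHalf m) :=
    ContDiffOn.inv (contDiff_cl_norm_sq.comp (contDiff_denom c d)).contDiffOn
      fun v hv => (norm_sq_pos (hV.denom_ne_zero hv)).ne'
  exact h1.smul ((LinearMap.toContinuousLinearMap (reverse (Q := negSq (m + 1)))).contDiff.comp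
    (contDiff_denom c d)).contDiffOn

lemma IsVahlen.J_mul_denom (hV : IsVahlen a b c d) (hε : ε = 1 ∨ ε = -1)
    (hc : involute c = (-ε) • c) (hd : involute d = ε • d) {v : E (m + 1)}
    (hv : v ∈ upperHalf m) : J c d v * (c * vec v + d) = ε • (1 : Cl (m + 1)) := by
  have hr := (norm_sq_pos (hV.denom_ne_zero hv)).ne'
  rw [J, smul_mul_assoc, reverse_mul_of_mem (hV.denom_mem v) hε (involute_denom hc hd v),
    smul_smul, mul_left_comm, inv_mul_cancel₀ hr, mul_one]

lemma IsVahlen.denom_mul_J (hV : IsVahlen a b c d) (hε : ε = 1 ∨ ε = -1)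
    (hc : involute c = (-ε) • c) (hd : involute d = ε • d) {v : E (m + 1)}
    (hv : v ∈ upperHalf m) : (c * vec v + d) * J c d v = ε • (1 : Cl (m + 1)) := by
  have hr := (norm_sq_pos (hV.denom_ne_zero hv)).ne'
  rw [J, mul_smul_comm, mul_reverse_of_mem (hV.denom_mem v) hε (involute_denom hc hd v),
    smul_smul, mul_left_comm, inv_mul_cancel₀ hr, mul_one]

lemma IsMoebiusOnUpperHalf.contDiffOn (h : IsMoebiusOnUpperHalf a b c d ψ) {k : WithTop ℕ∞} :
    ContDiffOn ℝ k ψ (upperHalf m) := by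
  obtain ⟨ε, hε, hc, hd⟩ := h.vahlen.exists_parity
  obtain ⟨p, hp⟩ := exists_vec_leftInverse (m + 1)
  have h1 : ContDiffOn ℝ k (fun v => p (ε • ((a * vec v + b) * J c d v))) (upperHalf m) :=
    p.contDiff.comp_contDiffOn
      ((contDiffOn_cl_mul (contDiff_denom a b).contDiffOn h.vahlen.contDiffOn_J).const_smul ε)
  refine h1.congr fun v hv => ?_
  rw [← h.mul_denom hv, mul_assoc, h.vahlen.denom_mul_J hε hc hd hv, mul_smul_comm, mul_one,
    smul_smul, sq_sign hε, one_smul, hp]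

lemma IsMoebiusOnUpperHalf.differentiableAt (h : IsMoebiusOnUpperHalf a b c d ψ) {v : E (m + 1)}
    (hv : v ∈ upperHalf m) : DifferentiableAt ℝ ψ v :=
  (h.contDiffOn (k := 1)).differentiableOn one_ne_zero |>.differentiableAt
    (isOpen_upperHalf.mem_nhds hv)

lemma IsVahlen.differentiableAt_J (h : IsVahlen a b c d) {v : E (m + 1)}
    (hv : v ∈ upperHalf m) : DifferentiableAt ℝ (J c d) v :=
  (h.contDiffOn_J (k := 1)).differentiableOn one_ne_zero |>.differentiableAt
    (isOpen_upperHalf.mem_nhds hv)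

/-- `‖g‖⁴ dψ(h) = g h g~`, where `g = c v + d`. -/
lemma IsMoebiusOnUpperHalf.vec_fderiv (h : IsMoebiusOnUpperHalf a b c d ψ)
    (hε : ε = 1 ∨ ε = -1) (hc : involute c = (-ε) • c) (hd : involute d = ε • d) {v : E (m + 1)}
    (hv : v ∈ upperHalf m) (x : E (m + 1)) :
    (‖c * vec v + d‖ ^ 2) ^ 2 • vec (fderiv ℝ ψ v x) =
      (c * vec v + d) * vec x * reverse (c * vec v + d) := by
  -- Differentiating this identity avoids differentiating an inverse.
  have h1 : (fun u => vec (ψ u) * (c * vec u + d)) =ᶠ[nhds v] fun u => a * vec u + b := by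
    filter_upwards [isOpen_upperHalf.mem_nhds hv] with u hu using h.mul_denom hu
  have hd1 : HasFDerivAt (fun u => vec (ψ u)) ((vecL (m + 1)).comp (fderiv ℝ ψ v)) v :=
    (vecL (m + 1)).hasFDerivAt.comp v (h.differentiableAt hv).hasFDerivAt
  have h2 := congrArg (fun f : E (m + 1) →L[ℝ] Cl (m + 1) => f x) h1.fderiv_eq
  rw [fderiv_cl_mul hd1.differentiableAt
    ((contDiff_denom (k := 1) c d).differentiable one_ne_zero v), fderiv_denom, fderiv_denom,
    hd1.fderiv] at h2
  have hs := h.norm_sq_smul_sub hε hc hd hv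
  have hgr := mul_reverse_of_mem (h.vahlen.denom_mem v) hε (involute_denom hc hd v)
  set g := c * vec v + d
  have h3 : vec (fderiv ℝ ψ v x) * g = (a - vec (ψ v) * c) * vec x := by
    rw [sub_mul, ← h2, mul_assoc]
    exact (add_sub_cancel_left _ _).symm
  have h4 := congrArg (fun A => (ε * ‖g‖ ^ 2) • (A * reverse g)) h3
  have h5 : (ε * ‖g‖ ^ 2) • (a - vec (ψ v) * c) = g := by
    rw [mul_smul, hs, smul_smul, sq_sign hε, one_smul]
  rw [mul_assoc, hgr, mul_smul_comm, mul_one, smul_smul, ← smul_mul_assoc, ← smul_mul_assoc,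
    h5] at h4
  rw [← h4]
  congr 1
  linear_combination (-(‖g‖ ^ 2) ^ 2) * sq_sign hε

/-- Moving a vector past `g~` replaces it by its image under `dψ`, up to a scalar; so the `e_j` of
the Dirac operator become `dψ(e_j)`. -/
lemma IsMoebiusOnUpperHalf.reverse_mul_vec_fderiv (h : IsMoebiusOnUpperHalf a b c d ψ)
    (hε : ε = 1 ∨ ε = -1) (hc : involute c = (-ε) • c) (hd : involute d = ε • d) {v : E (m + 1)}
    (hv : v ∈ upperHalf m) (x : E (m + 1)) :
    vec x * reverse (c * vec v + d) =
      (ε * ‖c * vec v + d‖ ^ 2) • (reverse (c * vec v + d) * vec (fderiv ℝ ψ v x)) := by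
  have h1 := h.vec_fderiv hε hc hd hv x
  have hrg := reverse_mul_of_mem (h.vahlen.denom_mem v) hε (involute_denom hc hd v)
  have hr := (norm_sq_pos (h.vahlen.denom_ne_zero hv)).ne'
  set g := c * vec v + d
  have h2 := congrArg (reverse g * ·) h1
  simp only [mul_smul_comm] at h2
  rw [← mul_assoc, ← mul_assoc, hrg, smul_mul_assoc, smul_mul_assoc, one_mul] at h2
  have h3 := congrArg ((ε * (‖g‖ ^ 2)⁻¹) • ·) h2
  simp only [smul_smul] at h3
  have h4 : ε * (‖g‖ ^ 2)⁻¹ * (ε * ‖g‖ ^ 2) = 1 := by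
    rw [mul_mul_mul_comm, sq_sign hε, inv_mul_cancel₀ hr, one_mul]
  rw [h4, one_smul] at h3
  rw [← h3]
  congr 1
  field_simp

/-- A Möbius transformation is conformal, with dilatation `‖c v + d‖⁻²`. -/
lemma IsMoebiusOnUpperHalf.norm_fderiv (h : IsMoebiusOnUpperHalf a b c d ψ) {v : E (m + 1)}
    (hv : v ∈ upperHalf m) (x : E (m + 1)) :
    ‖fderiv ℝ ψ v x‖ = (‖c * vec v + d‖ ^ 2)⁻¹ * ‖x‖ := by
  obtain ⟨ε, hε, hc, hd⟩ := h.vahlen.exists_parity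
  have h1 := h.reverse_mul_vec_fderiv hε hc hd hv x
  have h2 := h.vec_fderiv hε hc hd hv x
  have hr := norm_sq_pos (h.vahlen.denom_ne_zero hv)
  have hgr := mul_reverse_of_mem (h.vahlen.denom_mem v) hε (involute_denom hc hd v)
  set g := c * vec v + d
  set y := fderiv ℝ ψ v x
  -- Evaluate `g x g~ y` in two ways: `g x g~` is a multiple of `y`, and `g~ y` is a multiple of `x
  -- g~`.
  have h3 : (-(ε * ‖g‖ ^ 2 * (‖g‖ ^ 2) ^ 2 * ‖y‖ ^ 2)) • (1 : Cl (m + 1)) =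
      (-(ε * ‖g‖ ^ 2 * ‖x‖ ^ 2)) • (1 : Cl (m + 1)) := by
    calc (-(ε * ‖g‖ ^ 2 * (‖g‖ ^ 2) ^ 2 * ‖y‖ ^ 2)) • (1 : Cl (m + 1))
        = (ε * ‖g‖ ^ 2) • (((‖g‖ ^ 2) ^ 2 • vec y) * vec y) := by
          rw [smul_mul_assoc, vec_mul_self, Algebra.algebraMap_eq_smul_one]; module
      _ = g * vec x * ((ε * ‖g‖ ^ 2) • (reverse g * vec y)) := by
          rw [h2, mul_smul_comm, mul_assoc (g * vec x)]
      _ = g * (vec x * vec x) * reverse g := by rw [← h1]; simp only [mul_assoc]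
      _ = _ := by
          rw [vec_mul_self, Algebra.algebraMap_eq_smul_one, mul_smul_comm, mul_one,
            smul_mul_assoc, hgr]
          module
  have h4 := smul_left_injective ℝ (one_ne_zero (α := Cl (m + 1))) h3
  have hε0 : ε ≠ 0 := by rcases hε with rfl | rfl <;> norm_num
  have h5 : (‖g‖ ^ 2 * ‖y‖) ^ 2 = ‖x‖ ^ 2 := by
    apply mul_left_cancel₀ (mul_ne_zero hε0 hr.ne')
    linear_combination -h4
  rw [← (pow_left_inj₀ (by positivity) (by positivity) two_ne_zero).1 h5, inv_mul_cancel_left₀ hr.ne']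

/-- The derivative of `J` is `-ε ‖g‖⁻⁴ g~ c h g~`, where `g = c v + d`. -/
lemma IsVahlen.fderiv_J (hV : IsVahlen a b c d) (hε : ε = 1 ∨ ε = -1)
    (hc : involute c = (-ε) • c) (hd : involute d = ε • d) {v : E (m + 1)}
    (hv : v ∈ upperHalf m) (x : E (m + 1)) :
    fderiv ℝ (J c d) v x = (-ε * ((‖c * vec v + d‖ ^ 2) ^ 2)⁻¹) •
      (reverse (c * vec v + d) * c * vec x * reverse (c * vec v + d)) := by
  have h1 : (fun u => J c d u * (c * vec u + d)) =ᶠ[nhds v] fun _ => ε • (1 : Cl (m + 1)) := by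
    filter_upwards [isOpen_upperHalf.mem_nhds hv] with u hu using hV.J_mul_denom hε hc hd hu
  have h2 := congrArg (fun f : E (m + 1) →L[ℝ] Cl (m + 1) => f x) h1.fderiv_eq
  rw [fderiv_cl_mul (hV.differentiableAt_J hv)
    ((contDiff_denom (k := 1) c d).differentiable one_ne_zero v), fderiv_denom] at h2
  simp only [fderiv_fun_const, Pi.zero_apply, zero_apply] at h2
  have hJ := hV.denom_mul_J hε hc hd hv
  -- Right multiplication by `ε J = g⁻¹` isolates `dJ`.
  have h3 := congrArg (fun A => ε • (A * J c d v)) h2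
  simp only [add_mul] at h3
  rw [mul_assoc (fderiv ℝ (J c d) v x), hJ, mul_smul_comm, mul_one, smul_add, smul_smul,
    sq_sign hε, one_smul, zero_mul, smul_zero] at h3
  rw [eq_neg_of_add_eq_zero_right h3, J]
  simp only [smul_mul_assoc, mul_smul_comm, smul_smul, mul_assoc]
  module

/-! ### Transformation of `D`, `Q'` and `M`. -/

lemma IsVahlen.reverse_denom_mul_eLast (hV : IsVahlen a b c d) (hε : ε = 1 ∨ ε = -1)
    (hc : involute c = (-ε) • c) (hd : involute d = ε • d) (v : E (m + 1)) :
    ‖c * vec v + d‖ ^ 2 • (reverse (c * vec v + d) * eLast m) =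
      (2 * v (Fin.last m)) • (reverse (c * vec v + d) * c * reverse (c * vec v + d)) +
        (ε * ‖c * vec v + d‖ ^ 2) • (eLast m * reverse (c * vec v + d)) := by
  have h1 := hV.eLast_mul_denom hε hc hd v
  have hinv := involute_denom hc hd v
  have hgr := mul_reverse_of_mem (hV.denom_mem v) hε hinv
  have hrg := reverse_mul_of_mem (hV.denom_mem v) hε hinv
  set g := c * vec v + d
  have h2 : reverse g * (eLast m * g) * reverse g =
      (ε * ‖g‖ ^ 2) • (reverse g * eLast m) := by
    rw [mul_assoc, mul_assoc, hgr, mul_smul_comm, mul_one, mul_smul_comm]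
  have h3 : reverse g * (g * eLast m) * reverse g =
      (ε * ‖g‖ ^ 2) • (eLast m * reverse g) := by
    rw [← mul_assoc, hrg, smul_mul_assoc, smul_mul_assoc, one_mul]
  rw [h1, mul_add, add_mul, mul_smul_comm, mul_smul_comm, smul_mul_assoc, smul_mul_assoc, h3]
    at h2
  have h4 := congrArg (ε • ·) h2
  have hεε := sq_sign hε
  simp only [smul_add, smul_smul] at h4
  have e1 : ε * (2 * ε * v (Fin.last m)) = 2 * v (Fin.last m) := by
    linear_combination 2 * v (Fin.last m) * hεε
  have e2 : ε * (ε * (ε * ‖g‖ ^ 2)) = ε * ‖g‖ ^ 2 := by linear_combination ε * ‖g‖ ^ 2 * hεε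
  have e3 : ε * (ε * ‖g‖ ^ 2) = ‖g‖ ^ 2 := by linear_combination ‖g‖ ^ 2 * hεε
  rw [e1, e2, e3] at h4
  exact h4.symm

/-- In this form the behaviour of `Q'` under left multiplication by `J` reduces to commuting `e_n`
with `g~`. -/
lemma clQ'_eq (A : Cl (m + 1)) :
    clQ' A = (2⁻¹ : ℝ) • (involute A * eLast m - eLast m * A) := by
  have h : eLast m * (eLast m * involute A) = -involute A := by
    rw [← mul_assoc, eLast_mul_self, neg_one_mul]
  rw [clQ', clQ, mul_smul_comm, smul_mul_assoc, mul_add, add_mul, h, mul_neg, neg_mul,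
    ← mul_assoc, eLast_mul_mul, ← smul_neg]
  congr 1
  noncomm_ring

lemma IsMoebiusOnUpperHalf.fderiv_J_mul_comp (h : IsMoebiusOnUpperHalf a b c d ψ)
    {φ : E (m + 1) → Cl (m + 1)} {v : E (m + 1)} (hv : v ∈ upperHalf m)
    (hφ : DifferentiableAt ℝ φ (ψ v)) (x : E (m + 1)) :
    fderiv ℝ (fun u => J c d u * φ (ψ u)) v x =
      J c d v * fderiv ℝ φ (ψ v) (fderiv ℝ ψ v x) + fderiv ℝ (J c d) v x * φ (ψ v) := by
  rw [fderiv_cl_mul (g := fun u => φ (ψ u)) (h.vahlen.differentiableAt_J hv)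
    (hφ.comp v (h.differentiableAt hv))]
  rw [show (fun u => φ (ψ u)) = φ ∘ ψ from rfl, fderiv_comp v hφ (h.differentiableAt hv)]
  rfl

/-- The transformation of the Euclidean Dirac operator under `φ ↦ J φ ∘ ψ`; the weight of `J` is
not the conformal one, which produces the zero order term. -/
lemma IsMoebiusOnUpperHalf.euclDirac_J_mul_comp (h : IsMoebiusOnUpperHalf a b c d ψ)
    (hε : ε = 1 ∨ ε = -1) (hc : involute c = (-ε) • c) (hd : involute d = ε • d)
    {φ : E (m + 1) → Cl (m + 1)} {v : E (m + 1)} (hv : v ∈ upperHalf m)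
    (hφ : DifferentiableAt ℝ φ (ψ v)) :
    euclDirac (fun u => J c d u * φ (ψ u)) v =
      (ε * ((‖c * vec v + d‖ ^ 2) ^ 2)⁻¹) • (reverse (c * vec v + d) * euclDirac φ (ψ v) -
        (((m + 1 : ℕ) : ℝ) - 2) • (reverse (c * vec v + d) * c * reverse (c * vec v + d) *
          φ (ψ v))) := by
  obtain ⟨q, hq⟩ := h.vahlen.exists_vec_eq hε hc v
  have hr := norm_sq_pos (h.vahlen.denom_ne_zero hv)
  have hsum := sum_vec_mul_of_similarity (fderiv ℝ ψ v).toLinearMap (inv_pos.2 hr)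
    (h.norm_fderiv hv) (fderiv ℝ φ (ψ v)).toLinearMap
  have hcomm := h.reverse_mul_vec_fderiv hε hc hd hv
  have hJd := h.vahlen.fderiv_J hε hc hd hv
  simp only [ContinuousLinearMap.coe_coe] at hsum
  simp only [euclDirac, h.fderiv_J_mul_comp hv hφ, mul_add, Finset.sum_add_distrib, hJd]
  rw [J, hq]
  set g := c * vec v + d
  have h1 : ∀ j, vec (e j) * ((‖g‖ ^ 2)⁻¹ • reverse g *
      fderiv ℝ φ (ψ v) (fderiv ℝ ψ v (e j))) =
      ε • (reverse g * (vec (fderiv ℝ ψ v (e j)) *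
        fderiv ℝ φ (ψ v) (fderiv ℝ ψ v (e j)))) := by
    intro j
    rw [smul_mul_assoc, mul_smul_comm, ← mul_assoc, hcomm, smul_mul_assoc, smul_smul, mul_assoc,
      mul_left_comm, inv_mul_cancel₀ hr.ne', mul_one]
  have h2 : ∀ j, vec (e j) * ((-ε * ((‖g‖ ^ 2) ^ 2)⁻¹) •
      (vec q * vec (e j) * reverse g) * φ (ψ v)) =
      (-ε * ((‖g‖ ^ 2) ^ 2)⁻¹) • (vec (e j) * vec q * vec (e j) * (reverse g * φ (ψ v))) := by
    intro j
    simp only [smul_mul_assoc, mul_smul_comm, mul_assoc]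
  rw [Finset.sum_congr rfl fun j _ => h1 j, Finset.sum_congr rfl fun j _ => h2 j,
    ← Finset.smul_sum, ← Finset.smul_sum, ← Finset.mul_sum, ← Finset.sum_mul, hsum,
    sum_vec_e_mul_vec_mul, mul_smul_comm, smul_mul_assoc, ← mul_assoc (vec q), inv_pow]
  module

lemma IsMoebiusOnUpperHalf.clQ'_J_mul (h : IsMoebiusOnUpperHalf a b c d ψ)
    (hε : ε = 1 ∨ ε = -1) (hc : involute c = (-ε) • c) (hd : involute d = ε • d)
    {v : E (m + 1)} (hv : v ∈ upperHalf m) (A : Cl (m + 1)) :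
    clQ' (J c d v * A) = (ε * (‖c * vec v + d‖ ^ 2)⁻¹) • (reverse (c * vec v + d) * clQ' A) +
      (ε * ((‖c * vec v + d‖ ^ 2) ^ 2)⁻¹ * v (Fin.last m)) •
        (reverse (c * vec v + d) * c * reverse (c * vec v + d) * A) := by
  have hr := (norm_sq_pos (h.vahlen.denom_ne_zero hv)).ne'
  have h1 := h.vahlen.reverse_denom_mul_eLast hε hc hd v
  have hinv : involute (reverse (c * vec v + d)) = ε • reverse (c * vec v + d) := by
    rw [← CliffordAlgebra.reverse_involute, involute_denom hc hd, map_smul]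
  rw [clQ'_eq, clQ'_eq, J, smul_mul_assoc, map_smul, map_mul, hinv]
  set g := c * vec v + d
  have hεε := sq_sign hε
  have h2 : eLast m * reverse g = ε • (reverse g * eLast m) -
      (2 * ε * (‖g‖ ^ 2)⁻¹ * v (Fin.last m)) • (reverse g * c * reverse g) := by
    have h3 := congrArg ((ε * (‖g‖ ^ 2)⁻¹) • ·) h1
    simp only [smul_add, smul_smul] at h3
    have e1 : ε * (‖g‖ ^ 2)⁻¹ * ‖g‖ ^ 2 = ε := by rw [mul_assoc, inv_mul_cancel₀ hr, mul_one]
    have e2 : ε * (‖g‖ ^ 2)⁻¹ * (ε * ‖g‖ ^ 2) = 1 := by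
      rw [mul_mul_mul_comm, hεε, inv_mul_cancel₀ hr, one_mul]
    rw [e1, e2, one_smul] at h3
    rw [h3]; module
  have h3 : eLast m * (reverse g * A) = ε • (reverse g * (eLast m * A)) -
      (2 * ε * (‖g‖ ^ 2)⁻¹ * v (Fin.last m)) • (reverse g * c * reverse g * A) := by
    rw [← mul_assoc, h2, sub_mul, smul_mul_assoc, smul_mul_assoc, mul_assoc (reverse g) (eLast m)]
  rw [mul_smul_comm _ (eLast m), h3, mul_smul_comm _ (reverse g), mul_sub]
  simp only [smul_mul_assoc, mul_assoc (reverse g) (involute A)]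
  module

lemma IsMoebiusOnUpperHalf.diracHodge_J_mul_comp (h : IsMoebiusOnUpperHalf a b c d ψ)
    (hε : ε = 1 ∨ ε = -1) (hc : involute c = (-ε) • c) (hd : involute d = ε • d)
    {φ : E (m + 1) → Cl (m + 1)} {v : E (m + 1)} (hv : v ∈ upperHalf m)
    (hφ : DifferentiableAt ℝ φ (ψ v)) :
    diracHodge (fun u => J c d u * φ (ψ u)) v = ε • (J' c d v * diracHodge φ (ψ v)) := by
  have hr := (norm_sq_pos (h.vahlen.denom_ne_zero hv)).ne'
  have hx : v (Fin.last m) ≠ 0 := ne_of_gt hv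
  rw [diracHodge, diracHodge, h.euclDirac_J_mul_comp hε hc hd hv hφ, h.clQ'_J_mul hε hc hd hv,
    h.height_eq hv, J']
  -- The cancellation only needs the sandwich sum and the weight of `Q'` to share the same constant.
  generalize ((m + 1 : ℕ) : ℝ) - 2 = k
  set g := c * vec v + d
  have h4 : (‖g‖ ^ 4)⁻¹ = ((‖g‖ ^ 2) ^ 2)⁻¹ := by ring
  rw [h4]
  generalize ‖g‖ ^ 2 = r at *
  rw [smul_mul_assoc, mul_add, mul_smul_comm, smul_add, smul_add, smul_add, smul_sub]
  simp only [smul_smul]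
  have e1 : k / v (Fin.last m) * (ε * (r ^ 2)⁻¹ * v (Fin.last m)) = ε * (r ^ 2)⁻¹ * k := by
    field_simp
  have e2 : ε * ((r ^ 2)⁻¹ * (k / (v (Fin.last m) / r))) =
      k / v (Fin.last m) * (ε * r⁻¹) := by
    field_simp
  rw [e1, e2]
  abel

end DiracHodge

theorem theorem16 {m : ℕ} (hm : 2 < m + 1) (a b c d : Cl (m + 1))
    (ψ : E (m + 1) → E (m + 1)) (hψ : IsMoebiusOnUpperHalf a b c d ψ) :
    ∃ ε : ℝ, (ε = 1 ∨ ε = -1) ∧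
      (∀ v ∈ upperHalf m,
        CliffordAlgebra.involute (c * vec v + d) = ε • (c * vec v + d)) ∧
      ∀ U : Set (E (m + 1)), IsOpen U → U ⊆ upperHalf m →
        ∀ φ : E (m + 1) → Cl (m + 1), ContDiffOn ℝ 1 φ U →
          ContDiffOn ℝ 1 (fun v => J c d v * φ (ψ v)) (upperHalf m ∩ ψ ⁻¹' U) ∧
          ∀ v ∈ upperHalf m, ψ v ∈ U →
            diracHodge (fun u => J c d u * φ (ψ u)) v =
              ε • (J' c d v * diracHodge φ (ψ v)) := by
  obtain ⟨ε, hε, hc, hd⟩ := hψ.vahlen.exists_parity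
  refine ⟨ε, hε, fun v _ => involute_denom hc hd v, fun U hU _ φ hφ => ⟨?_, fun v hv hvU => ?_⟩⟩
  · exact contDiffOn_cl_mul (hψ.vahlen.contDiffOn_J.mono Set.inter_subset_left)
      (hφ.comp (hψ.contDiffOn.mono Set.inter_subset_left) fun _ hv => hv.2)
  · exact hψ.diracHodge_J_mul_comp hε hc hd hv
      ((hφ.differentiableOn one_ne_zero).differentiableAt (hU.mem_nhds hvU))
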